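/- **Lemma 3.3.** Let $L>0$ and let $\mathbb{H}^2$ be the hyperbolic plane, in the Poincaré disc model with origin $o$ and with the metric $d_h(x,y)=\cosh^{-1}\bigl(1+\tfrac{2|x-y|^2}{(1-|x|^2)(1-|y|^2)}\bigr)$. Let $v^h$ be the hyperbolic area measure, $\theta(x)\in[0,2\pi)$ the polar angle of $x$, and $\mu=v^h\otimes\Phi$ on $\mathbb{H}^2\times[0,\pi)$, where $\Phi$ is the uniform probability measure on $[0,\pi)$. For $(x,\phi)\in\mathbb{H}^2\times[0,\pi)$ let $l_L(x,\phi)$ be the stick (geodesic segment) of length $L$ with centre $x$ whose angle, counterclockwise from the geodesic through $o$ and $x$, is $\phi$; precisely, $l_L(x,\phi)=\mathcal{I}^x\bigl(l_L(o,\phi+\theta(x))\bigr)$, where $l_L(o,\psi)$ is the segment of length $L$ with centre $o$ and angle $\psi$ to the horizontal axis, and $\mathcal{I}^x(z)=\frac{z+x}{1+\bar x z}$ is the translation taking $o$ to $x$. Let $g_0^+=\{x:\ 0\le x<1\}$ be the positive horizontal ray from $o$, and let $\mathcal{H}$ be the set of all $(x,\phi)\in\mathbb{H}^2\times[0,\pi)$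 with $l_L(x,\phi)\cap g_0^+\neq\emptyset$. For $\mu$-almost every $(x,\phi)\in\mathcal{H}$ there is exactly one triple $T(x,\phi)=(\rho',\varphi,r)$ such that, for some point $p\in l_L(x,\phi)\cap g_0^+$: $\rho'=d_h(o,p)$; $\varphi\in[0,\pi)$ is the angle, counterclockwise, from $g_0^+$ to the stick at $p$; and $r$ is the signed distance from $p$ to the centre $x$ ($|r|=d_h(p,x)$, with $r>0$ if $x$ lies in direction $\varphi$ from $p$, and $r<0$ if $x$ lies in the opposite direction). The map $T$ is $\mu$-almost everywhere measurable on $\mathcal{H}$, and the image under $T$ of the restriction of $\mu$ to $\mathcal{H}$, that is, the measure $\mu'(A)=\mu(\mathcal{H}\cap T^{-1}(A))$, is $$ \mathrm{d}\mu'=\frac1\pi\,\mathrm{d}\rho'\otimes\sin\varphi\,\mathrm{d}\varphi\otimes\mathrm{d}r \qquad\text{on } [0,\infty)\times[0,\pi)\times[-L/2,L/2]. $$ -/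

import Mathlib

noncomputable section

namespace HypStick

open MeasureTheory

/-- The hyperbolic plane in the Poincaré disc model: the open unit disc of `ℂ`. -/
def disc : Set ℂ := {z | ‖z‖ < 1}

/-- The hyperbolic distance of two points of the unit disc. -/
def hdist (x y : ℂ) : ℝ :=
  Real.arcosh (1 + 2 * ‖x - y‖ ^ 2 / ((1 - ‖x‖ ^ 2) * (1 - ‖y‖ ^ 2)))

/-- The hyperbolic area measure, carried by the unit disc: the Riemannian metric whose distance is
`hdist` is `4 |dz|² / (1 - |z|²)²`. In hyperbolic polar coordinates this is `sinh ρ dρ dθ`. -/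
def hypArea : Measure ℂ :=
  (volume.restrict disc).withDensity fun z => ENNReal.ofReal (4 / (1 - ‖z‖ ^ 2) ^ 2)

/-- The uniform probability measure on `[0, π)`. -/
def unifAngle : Measure ℝ :=
  ENNReal.ofReal (1 / Real.pi) • volume.restrict (Set.Ico 0 Real.pi)

/-- The intensity measure of sticks, on pairs (centre, angle) in `disc × [0, π)`. -/
def stickMeasure : Measure (ℂ × ℝ) := hypArea.prod unifAngle

/-- The geodesic through the origin `0` with angle `θ` to the positive horizontal axis: the points
with polar angle `θ` or `θ + π`, and `0`. It depends on `θ` modulo `π` only. -/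
def geod (θ : ℝ) : Set ℂ :=
  {z | ∃ u : ℝ, |u| < 1 ∧ z = (u : ℂ) * Complex.exp (θ * Complex.I)}

/-- The positive horizontal ray from the origin. -/
def posRay : Set ℂ := {z | ∃ u : ℝ, 0 ≤ u ∧ u < 1 ∧ z = (u : ℂ)}

/-- The translation that moves `0` to `x`: the orientation preserving isometry of the disc with
`0 ↦ x` that fixes both ends `± x / ‖x‖` of the geodesic through `0` and `x`
(the identity if `x = 0`). -/
def transl (x z : ℂ) : ℂ := (z + x) / (1 + (starRingEnd ℂ) x * z)

/-- The stick of length `L` centred at the origin, with angle `φ` to the horizontal axis. -/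
def stickAtZero (L φ : ℝ) : Set ℂ := {z | z ∈ geod φ ∧ hdist 0 z ≤ L / 2}

/-- The stick of length `L` centred at `x`, with angle `φ` (counterclockwise) from the geodesic
through `0` and `x`. As `geod` has period `π`, the angle `φ + θ(x)` need not be reduced modulo `π`,
and it does not matter which value of the argument of `x` is used. -/
def stick (L : ℝ) (x : ℂ) (φ : ℝ) : Set ℂ := transl x '' stickAtZero L (φ + x.arg)

/-- The pairs (centre, angle) in `disc × [0, π)` whose stick of length `L` hits the positive
horizontal ray. -/
def hitting (L : ℝ) : Set (ℂ × ℝ) :=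
  {q | q.1 ∈ disc ∧ q.2 ∈ Set.Ico 0 Real.pi ∧ (stick L q.1 q.2 ∩ posRay).Nonempty}

/-- `IsAltCoord L x φ ρ' ϕ r`: the stick of length `L` with centre `x` and angle `φ` is represented
by the triple `(ρ', ϕ, r)`, that is, there is a point `p` at which it hits the positive horizontal
ray such that
* `ρ'` is the distance from the origin to `p`;
* `ϕ ∈ [0, π)` is the angle, counterclockwise, from the ray to the stick at `p`: the stick lies on
  the geodesic obtained from `geod ϕ` by translating `0` to `p` along the horizontal axis;
* `r` is the signed distance from `p` to the centre `x`: it is positive if `x` lies in direction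
  `ϕ` from `p`, and negative if `x` lies in the opposite direction `ϕ + π`. -/
def IsAltCoord (L : ℝ) (x : ℂ) (φ ρ' ϕ r : ℝ) : Prop :=
  ∃ p ∈ stick L x φ ∩ posRay,
    ρ' = hdist 0 p ∧
    (ϕ ∈ Set.Ico 0 Real.pi ∧ stick L x φ ⊆ transl p '' geod ϕ) ∧
    (|r| = hdist p x ∧
      ∃ u : ℝ, |u| < 1 ∧ x = transl p (u * Complex.exp (ϕ * Complex.I)) ∧ 0 ≤ u * r)

/-- The reparametrization, which sends (centre, angle) to the triple `(ρ', ϕ, r)`. The triple is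
unique unless the stick is contained in the horizontal axis; for such a stick (and for a stick that
does not hit the ray) the value is arbitrary. -/
def altCoord (L : ℝ) (q : ℂ × ℝ) : ℝ × ℝ × ℝ :=
  Classical.epsilon fun t => IsAltCoord L q.1 q.2 t.1 t.2.1 t.2.2

/-- The measure `(1/π) dρ' ⊗ sin ϕ dϕ ⊗ dr` on `[0, ∞) × [0, π) × [-L/2, L/2]`. -/
def altMeasure (L : ℝ) : Measure (ℝ × ℝ × ℝ) :=
  (ENNReal.ofReal (1 / Real.pi) • volume.restrict (Set.Ici 0)).prod
    (((volume.restrict (Set.Ico 0 Real.pi)).withDensity fun ϕ => ENNReal.ofReal (Real.sin ϕ)).prod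
      (volume.restrict (Set.Icc (-L / 2) (L / 2))))

end HypStick

end

/-!
A stick is described by its centre `x` and its angle `φ`; the theorem passes to the point `p` at
which it crosses the positive real ray, the angle `ϕ` at `p`, and the signed distance `r` from `p`
to `x`. Almost every centre lies off the real axis, and almost every `φ` lies in `(0, π)`. Then
the stick meets the ray in at most one point `p = hitPoint x φ`, the root in `(0, 1)` of a quadratic
equation whose coefficient `hitCoth x φ` is affine in `cot φ`; and `(ϕ, r)` are the signed polar
coordinates of `relCenter p x`, the centre moved by the translation that takes `p` to `0`. This
explicit formula, `coordAt (hitPoint x φ) x`, is measurable and is the only triple of the stick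
(`isAltCoord_iff`).

The measure is computed in three moves.

* For a fixed centre `x`, the variable `φ` is replaced by `p` (`setLIntegral_hitPoint`). If `w` is
  the relative centre, then `|dφ/dp| = (1 - |w|²) |Im w| / ((1 - p²) |w|²)`; in hyperbolic terms
  this is `dφ = (sin ϕ / sinh |r|) dρ'`, the angle under which a displacement `dρ'` of `p` is seen
  from `x`.
* By Tonelli's theorem, `p` may be fixed instead. The hyperbolic area is invariant under
  translations (`lintegral_hypArea_transl_neg`), so that `x` may be replaced by `w`.
* In signed polar coordinates (`lintegral_signed_polar`), the area of the relative centre is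
  `sinh |r| dr dϕ`. The factor `sinh |r|` cancels and `sin ϕ dρ' dϕ dr` is left
  (`lintegral_hypArea_angDensity`). The factor `1 / π` is that of the uniform angle.

Hyperbolic lengths are handled by `hdist x y = 2 artanh |w|`, with `w` the position of `y` relative
to `x`, and the substitution `r = 2 artanh u` of `lintegral_two_mul_artanh`.
-/

noncomputable section

namespace HypStick

open MeasureTheory Set
open scoped ComplexConjugate ENNReal

/-! ### Translations and the hyperbolic distance -/

theorem cosh_two_mul_artanh {t : ℝ} (ht : t ∈ Ioo (-1) 1) :
    Real.cosh (2 * Real.artanh t) = (1 + t ^ 2) / (1 - t ^ 2) := by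
  have h : 0 < 1 - t ^ 2 := by nlinarith [ht.1, ht.2]
  rw [Real.cosh_two_mul, Real.cosh_artanh ht, Real.sinh_artanh ht, div_pow, div_pow,
    Real.sq_sqrt h.le]
  field_simp

theorem one_add_conj_mul_ne_zero {x z : ℂ} (hx : x ∈ disc) (hz : z ∈ disc) :
    1 + conj x * z ≠ 0 := by
  intro h
  have h1 : ‖conj x * z‖ = 1 := by
    rw [show conj x * z = -1 by linear_combination h]; simp
  rw [norm_mul, RCLike.norm_conj] at h1
  have hx' : ‖x‖ < 1 := hx
  have hz' : ‖z‖ < 1 := hz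
  nlinarith [norm_nonneg x, norm_nonneg z]

theorem one_sub_normSq_transl {x z : ℂ} (hx : x ∈ disc) (hz : z ∈ disc) :
    1 - ‖transl x z‖ ^ 2 = (1 - ‖x‖ ^ 2) * (1 - ‖z‖ ^ 2) / ‖1 + conj x * z‖ ^ 2 := by
  have h := one_add_conj_mul_ne_zero hx hz
  have h' : ‖1 + conj x * z‖ ^ 2 ≠ 0 := by simpa using h
  rw [transl, norm_div, div_pow, eq_div_iff h', sub_mul, div_mul_cancel₀ _ h']
  simp only [Complex.sq_norm, Complex.normSq_apply, Complex.add_re, Complex.add_im,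
    Complex.mul_re, Complex.mul_im, Complex.conj_re, Complex.conj_im, Complex.one_re,
    Complex.one_im]
  ring

theorem mem_disc_iff {x : ℂ} : x ∈ disc ↔ 0 < 1 - ‖x‖ ^ 2 := by
  change ‖x‖ < 1 ↔ _
  rw [sub_pos, sq_lt_one_iff₀ (norm_nonneg x)]

theorem transl_mem_disc {x z : ℂ} (hx : x ∈ disc) (hz : z ∈ disc) : transl x z ∈ disc := by
  rw [mem_disc_iff, one_sub_normSq_transl hx hz]
  have h := one_add_conj_mul_ne_zero hx hz
  have := mem_disc_iff.1 hx
  have := mem_disc_iff.1 hz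
  positivity

theorem neg_mem_disc {x : ℂ} (hx : x ∈ disc) : -x ∈ disc := by
  simpa [disc] using hx

theorem ofReal_mem_disc {u : ℝ} : (u : ℂ) ∈ disc ↔ |u| < 1 := by
  simp [disc]

theorem one_sub_conj_mul_self_ne_zero {x : ℂ} (hx : x ∈ disc) : 1 - conj x * x ≠ 0 := by
  have := one_add_conj_mul_ne_zero hx (neg_mem_disc hx)
  rwa [mul_neg, ← sub_eq_add_neg] at this

theorem transl_neg_transl {x z : ℂ} (hx : x ∈ disc) (hz : z ∈ disc) :
    transl (-x) (transl x z) = z := by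
  have h := one_add_conj_mul_ne_zero hx hz
  have h1 := one_sub_conj_mul_self_ne_zero hx
  have h2 : 1 + conj (-x) * transl x z ≠ 0 :=
    one_add_conj_mul_ne_zero (neg_mem_disc hx) (transl_mem_disc hx hz)
  have h' : 1 + z * conj x ≠ 0 := by rwa [mul_comm]
  rw [transl, div_eq_iff h2, transl, map_neg]
  field_simp
  ring

theorem transl_transl_neg {x z : ℂ} (hx : x ∈ disc) (hz : z ∈ disc) :
    transl x (transl (-x) z) = z := by
  simpa using transl_neg_transl (neg_mem_disc hx) hz

/-- The hyperbolic distance is twice the `artanh` of the pseudohyperbolic distance. -/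
theorem hdist_eq_artanh {x y : ℂ} (hx : x ∈ disc) (hy : y ∈ disc) :
    hdist x y = 2 * Real.artanh ‖transl (-x) y‖ := by
  have h0 : ‖transl (-x) y‖ < 1 := transl_mem_disc (neg_mem_disc hx) hy
  have h1 : ‖transl (-x) y‖ ∈ Ioo (-1 : ℝ) 1 := ⟨by linarith [norm_nonneg (transl (-x) y)], h0⟩
  have hpos := Real.artanh_nonneg (norm_nonneg (transl (-x) y))
  rw [← Real.arcosh_cosh (x := 2 * Real.artanh ‖transl (-x) y‖) (by positivity),
    cosh_two_mul_artanh h1, hdist]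
  congr 1
  have h := one_add_conj_mul_ne_zero (neg_mem_disc hx) hy
  have hx' := mem_disc_iff.1 hx
  have hy' := mem_disc_iff.1 hy
  have e := one_sub_normSq_transl (neg_mem_disc hx) hy
  have e2 : ‖transl (-x) y‖ ^ 2 = ‖x - y‖ ^ 2 / ‖1 + conj (-x) * y‖ ^ 2 := by
    rw [transl, norm_div, div_pow, ← sub_eq_add_neg, norm_sub_rev]
  have h' : 0 < ‖1 + conj (-x) * y‖ ^ 2 := by positivity
  set D := ‖1 + conj (-x) * y‖ ^ 2
  have e3 : 1 + ‖transl (-x) y‖ ^ 2 = (1 - ‖transl (-x) y‖ ^ 2) + 2 * ‖transl (-x) y‖ ^ 2 := by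
    ring
  rw [e3, e, e2, norm_neg]
  field_simp

theorem hdist_zero_left {z : ℂ} (hz : z ∈ disc) : hdist 0 z = 2 * Real.artanh ‖z‖ := by
  rw [hdist_eq_artanh (by simp [disc]) hz]
  simp [transl]

theorem hdist_comm (x y : ℂ) : hdist x y = hdist y x := by
  rw [hdist, hdist, norm_sub_rev, mul_comm (1 - ‖x‖ ^ 2)]

theorem hdist_zero_transl_neg {x y : ℂ} (hx : x ∈ disc) (hy : y ∈ disc) :
    hdist 0 (transl (-x) y) = hdist x y := by
  rw [hdist_zero_left (transl_mem_disc (neg_mem_disc hx) hy), hdist_eq_artanh hx hy]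

theorem norm_one_add_div {p w : ℂ} (hp : p ∈ disc) (hw : w ∈ disc) :
    ‖(1 + p * conj w) / (1 + conj p * w)‖ = 1 := by
  have e : conj (1 + conj p * w) = 1 + p * conj w := by simp
  rw [norm_div, ← e, RCLike.norm_conj, div_self]
  simpa using one_add_conj_mul_ne_zero hp hw

/-- Translating by `w` and then by `p` is a rotation about `0` followed by one translation. -/
theorem transl_transl {p w z : ℂ} (hp : p ∈ disc) (hw : w ∈ disc) (hz : z ∈ disc) :
    transl p (transl w z) =
      transl (transl p w) ((1 + p * conj w) / (1 + conj p * w) * z) := by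
  have h1 := one_add_conj_mul_ne_zero hp hw
  have h1' : 1 + p * conj w ≠ 0 := by
    have := one_add_conj_mul_ne_zero hw hp
    rwa [mul_comm] at this
  have h2 := one_add_conj_mul_ne_zero hw hz
  have h3 := one_add_conj_mul_ne_zero hp (transl_mem_disc hw hz)
  have hk : (1 + p * conj w) / (1 + conj p * w) * z ∈ disc := by
    change ‖_‖ < 1
    rw [norm_mul, norm_one_add_div hp hw, one_mul]
    exact hz
  have h4 := one_add_conj_mul_ne_zero (transl_mem_disc hp hw) hk
  unfold transl at *
  rw [div_eq_div_iff h3 h4]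
  simp only [map_div₀, map_add, map_one, map_mul, Complex.conj_conj]
  have h1a : 1 + w * conj p ≠ 0 := by rwa [mul_comm]
  have h1b : 1 + conj w * p ≠ 0 := by rwa [mul_comm]
  have h2a : 1 + z * conj w ≠ 0 := by rwa [mul_comm]
  field_simp
  ring

/-! ### Signed polar coordinates -/

/-- The signed distance parameter of `w` on the diameter through `w`: positive in the closed upper
half plane, negative below. -/
def polarRad (w : ℂ) : ℝ := if 0 ≤ w.im then ‖w‖ else -‖w‖

/-- The direction of the diameter through `w`, as an angle that lies in `[0, π)` unless `w` is
a negative real number. -/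
def polarAng (w : ℂ) : ℝ := if 0 ≤ w.im then w.arg else w.arg + Real.pi

theorem abs_polarRad (w : ℂ) : |polarRad w| = ‖w‖ := by
  unfold polarRad; split_ifs <;> simp

theorem polarRad_mul_exp (w : ℂ) :
    (polarRad w : ℂ) * Complex.exp (polarAng w * Complex.I) = w := by
  unfold polarRad polarAng; split_ifs
  · exact Complex.norm_mul_exp_arg_mul_I w
  · push_cast
    rw [add_mul, Complex.exp_add, Complex.exp_pi_mul_I]
    linear_combination Complex.norm_mul_exp_arg_mul_I w

theorem polarAng_mem {w : ℂ} (hw : w.im ≠ 0) : polarAng w ∈ Ioo 0 Real.pi := by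
  unfold polarAng; split_ifs with h
  · have h' : 0 < w.im := lt_of_le_of_ne h (Ne.symm hw)
    refine ⟨lt_of_le_of_ne (Complex.arg_nonneg_iff.2 h) fun h0 => hw ?_,
      lt_of_le_of_ne (Complex.arg_le_pi w) fun h0 => hw ?_⟩
    · exact (Complex.arg_eq_zero_iff.1 h0.symm).2
    · exact (Complex.arg_eq_pi_iff.1 h0).2
  · push Not at h
    exact ⟨by linarith [Complex.neg_pi_lt_arg w], by linarith [Complex.arg_neg_iff.2 h]⟩

theorem im_ofReal_mul_exp (u θ : ℝ) :
    ((u : ℂ) * Complex.exp (θ * Complex.I)).im = u * Real.sin θ := by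
  rw [Complex.im_ofReal_mul, Complex.exp_ofReal_mul_I_im]

theorem norm_ofReal_mul_exp (u θ : ℝ) :
    ‖(u : ℂ) * Complex.exp (θ * Complex.I)‖ = |u| := by
  rw [norm_mul, Complex.norm_exp_ofReal_mul_I, mul_one, Complex.norm_real, Real.norm_eq_abs]

theorem polarRad_ofReal_mul_exp {u θ : ℝ} (hθ : θ ∈ Ioo 0 Real.pi) :
    polarRad (u * Complex.exp (θ * Complex.I)) = u := by
  have hs := Real.sin_pos_of_mem_Ioo hθ
  rw [polarRad, im_ofReal_mul_exp, norm_ofReal_mul_exp]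
  split_ifs with h
  · exact abs_of_nonneg (nonneg_of_mul_nonneg_left h hs)
  · push Not at h
    rw [abs_of_neg (by nlinarith), neg_neg]

theorem polarAng_ofReal_mul_exp {u θ : ℝ} (hu : u ≠ 0) (hθ : θ ∈ Ioo 0 Real.pi) :
    polarAng (u * Complex.exp (θ * Complex.I)) = θ := by
  set w := (u : ℂ) * Complex.exp (θ * Complex.I) with hw
  have hs := Real.sin_pos_of_mem_Ioo hθ
  have him : w.im ≠ 0 := by rw [hw, im_ofReal_mul_exp]; positivity
  have h1 := polarRad_mul_exp w
  rw [polarRad_ofReal_mul_exp hθ] at h1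
  have h2 : Complex.exp (polarAng w * Complex.I) = Complex.exp (θ * Complex.I) :=
    mul_left_cancel₀ (by exact_mod_cast hu) (h1.trans hw)
  have h3 := congrArg Complex.re h2
  rw [Complex.exp_ofReal_mul_I_re, Complex.exp_ofReal_mul_I_re] at h3
  exact Real.injOn_cos (Ioo_subset_Icc_self (polarAng_mem him)) (Ioo_subset_Icc_self hθ) h3

/-! ### Geodesics and sticks -/

theorem geod_subset_disc (θ : ℝ) : geod θ ⊆ disc := by
  rintro _ ⟨u, hu, rfl⟩
  change ‖_‖ < 1
  rwa [norm_ofReal_mul_exp]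

theorem mem_geod_iff {z : ℂ} (hz : z ∈ disc) (θ : ℝ) :
    z ∈ geod θ ↔ (z * Complex.exp (-(θ * Complex.I))).im = 0 := by
  constructor
  · rintro ⟨u, -, rfl⟩
    rw [mul_assoc, ← Complex.exp_add, add_neg_cancel, Complex.exp_zero, mul_one,
      Complex.ofReal_im]
  · intro h
    have hz' : z = ((z * Complex.exp (-(θ * Complex.I))).re : ℂ) * Complex.exp (θ * Complex.I) := by
      rw [show ((z * Complex.exp (-(θ * Complex.I))).re : ℂ) = z * Complex.exp (-(θ * Complex.I))
        from Complex.ext (by simp) (by simp [h]), mul_assoc, ← Complex.exp_add, neg_add_cancel,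
        Complex.exp_zero, mul_one]
    refine ⟨_, ?_, hz'⟩
    rw [← norm_ofReal_mul_exp _ θ, ← hz']
    exact hz

theorem mem_stick_iff {L φ : ℝ} {x y : ℂ} (hx : x ∈ disc) (hy : y ∈ disc) :
    y ∈ stick L x φ ↔ transl (-x) y ∈ geod (φ + x.arg) ∧ hdist x y ≤ L / 2 := by
  constructor
  · rintro ⟨z, ⟨hz, hd⟩, rfl⟩
    have hz' := geod_subset_disc _ hz
    rw [← hdist_zero_transl_neg hx hy, transl_neg_transl hx hz']
    exact ⟨by simpa using hz, hd⟩
  · rintro ⟨h1, h2⟩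
    refine ⟨_, ⟨by simpa using h1, ?_⟩, transl_transl_neg hx hy⟩
    rwa [hdist_zero_transl_neg hx hy]

/-- The geodesic through `x` at angle `φ` to the diameter of `x` passes through the point `p` of the
real diameter iff `p` solves a quadratic equation. -/
theorem transl_neg_mem_geod_iff {x : ℂ} {p φ : ℝ} (hx : x ∈ disc) (hx0 : x ≠ 0) (hp : |p| < 1) :
    transl (-x) p ∈ geod (φ + x.arg) ↔
      Real.cos φ * (p * (x.im * (1 - ‖x‖ ^ 2))) =
        Real.sin φ * (‖x‖ ^ 2 * (1 + p ^ 2) - p * (x.re * (1 + ‖x‖ ^ 2))) := by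
  have hp' : (p : ℂ) ∈ disc := ofReal_mem_disc.2 hp
  have hnx : 0 < ‖x‖ := norm_pos_iff.2 hx0
  rw [mem_geod_iff (transl_mem_disc (neg_mem_disc hx) hp')]
  have hD := one_add_conj_mul_ne_zero (neg_mem_disc hx) hp'
  set D := 1 + conj (-x) * (p : ℂ) with hDdef
  have hDn : 0 < ‖D‖ := norm_pos_iff.2 hD
  have harg : (‖x‖ : ℂ) * Complex.exp (-(x.arg * Complex.I)) = conj x := by
    have := congrArg conj (Complex.norm_mul_exp_arg_mul_I x)
    rwa [map_mul, Complex.conj_ofReal, ← Complex.exp_conj, map_mul, Complex.conj_I,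
      Complex.conj_ofReal, mul_neg] at this
  -- Clearing the positive real factors `‖x‖` and `‖D‖ ^ 2` leaves a polynomial in `p` and `x`.
  have key : ((‖x‖ * ‖D‖ ^ 2 : ℝ) : ℂ) *
      (transl (-x) p * Complex.exp (-(((φ + x.arg : ℝ) : ℂ) * Complex.I))) =
      (p - x) * (1 - x * p) * conj x * Complex.exp ((-φ : ℝ) * Complex.I) := by
    have e1 : ((‖D‖ ^ 2 : ℝ) : ℂ) * transl (-x) p = (p - x) * (1 - x * p) := by
      have h2 : transl (-x) p = (p - x) / D := by rw [transl, ← sub_eq_add_neg]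
      have h3 : ((‖D‖ ^ 2 : ℝ) : ℂ) = conj D * D := by
        rw [mul_comm, Complex.mul_conj, Complex.normSq_eq_norm_sq]
      rw [h2, h3, mul_assoc, mul_div_cancel₀ _ hD, hDdef]
      simp
      ring
    have e2 : Complex.exp (-(((φ + x.arg : ℝ) : ℂ) * Complex.I)) =
        Complex.exp ((-φ : ℝ) * Complex.I) * Complex.exp (-(x.arg * Complex.I)) := by
      rw [← Complex.exp_add]; congr 1; push_cast; ring
    rw [e2, ← harg, ← e1]
    push_cast
    ring
  have key2 := congrArg Complex.im key
  rw [Complex.im_ofReal_mul] at key2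
  have hpos : ‖x‖ * ‖D‖ ^ 2 ≠ 0 := by positivity
  have h0 : ∀ t : ℝ, t = 0 ↔ ‖x‖ * ‖D‖ ^ 2 * t = 0 := fun t => by simp [hpos]
  rw [h0, key2, ← sub_eq_zero (a := Real.cos φ * _)]
  have him : ((p - x) * (1 - x * p) * conj x * Complex.exp ((-φ : ℝ) * Complex.I)).im =
      -(Real.cos φ * (p * (x.im * (1 - ‖x‖ ^ 2))) -
        Real.sin φ * (‖x‖ ^ 2 * (1 + p ^ 2) - p * (x.re * (1 + ‖x‖ ^ 2)))) := by
    rw [Complex.mul_im, Complex.exp_ofReal_mul_I_re, Complex.exp_ofReal_mul_I_im,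
      Real.cos_neg, Real.sin_neg, Complex.sq_norm, Complex.normSq_apply]
    simp
    ring
  rw [him, neg_eq_zero]

/-! ### The crossing point of a stick with the positive real ray -/

/-- The hyperbolic cotangent of the distance from `0` at which the geodesic of the stick with
centre `x` and angle `φ` crosses the positive real ray. Its intersections with the real line are the
roots of `p ^ 2 + 1 = 2 * hitCoth x φ * p`, and the ray is crossed iff `1 < hitCoth x φ`. -/
def hitCoth (x : ℂ) (φ : ℝ) : ℝ :=
  (Real.cos φ / Real.sin φ * (x.im * (1 - ‖x‖ ^ 2)) + x.re * (1 + ‖x‖ ^ 2)) / (2 * ‖x‖ ^ 2)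

/-- The point at which the geodesic of the stick crosses the positive real ray, as the smaller root
of `p ^ 2 + 1 = 2 * hitCoth x φ * p`. It is meaningful only if `1 < hitCoth x φ`. -/
def hitPoint (x : ℂ) (φ : ℝ) : ℝ := hitCoth x φ - √(hitCoth x φ ^ 2 - 1)

theorem sq_add_one_eq_two_mul_iff {k p : ℝ} :
    (p ∈ Ioo 0 1 ∧ p ^ 2 + 1 = 2 * k * p) ↔ 1 < k ∧ p = k - √(k ^ 2 - 1) := by
  constructor
  · rintro ⟨⟨h0, h1⟩, h⟩
    have hk : 1 < k := by nlinarith [sq_nonneg (p - 1), mul_pos h0 (sub_pos.2 h1)]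
    refine ⟨hk, ?_⟩
    rw [show k ^ 2 - 1 = (k - p) ^ 2 by linarith, Real.sqrt_sq (by linarith)]
    ring
  · rintro ⟨hk, rfl⟩
    have h0 : 0 ≤ k ^ 2 - 1 := by nlinarith
    have hs := Real.sq_sqrt h0
    have hs0 : 0 ≤ √(k ^ 2 - 1) := Real.sqrt_nonneg _
    refine ⟨⟨?_, ?_⟩, by linarith⟩ <;> nlinarith

theorem sq_add_one_eq_hitCoth_iff {x : ℂ} {p φ : ℝ} (hx0 : x ≠ 0) (hφ : Real.sin φ ≠ 0) :
    p ^ 2 + 1 = 2 * hitCoth x φ * p ↔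
      Real.cos φ * (p * (x.im * (1 - ‖x‖ ^ 2))) =
        Real.sin φ * (‖x‖ ^ 2 * (1 + p ^ 2) - p * (x.re * (1 + ‖x‖ ^ 2))) := by
  have hnx : 0 < ‖x‖ := norm_pos_iff.2 hx0
  have e : 2 * hitCoth x φ * p = (Real.cos φ * (p * (x.im * (1 - ‖x‖ ^ 2))) +
      Real.sin φ * (p * (x.re * (1 + ‖x‖ ^ 2)))) / (Real.sin φ * ‖x‖ ^ 2) := by
    rw [hitCoth]; field_simp
  rw [e, eq_div_iff (by positivity)]
  constructor <;> intro h <;> linarith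

theorem ofReal_mem_stick_iff {L φ p : ℝ} {x : ℂ} (hx : x ∈ disc) (hx0 : x ≠ 0)
    (hφ : φ ∈ Ioo 0 Real.pi) (hp : p ∈ Ico 0 1) :
    (p : ℂ) ∈ stick L x φ ↔
      1 < hitCoth x φ ∧ p = hitPoint x φ ∧ hdist p x ≤ L / 2 := by
  have hs := Real.sin_pos_of_mem_Ioo hφ
  have hp1 : |p| < 1 := by rw [abs_of_nonneg hp.1]; exact hp.2
  have hnx : 0 < ‖x‖ := norm_pos_iff.2 hx0
  rw [mem_stick_iff hx (ofReal_mem_disc.2 hp1), transl_neg_mem_geod_iff hx hx0 hp1,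
    ← sq_add_one_eq_hitCoth_iff hx0 hs.ne', hdist_comm, ← and_assoc, hitPoint,
    ← sq_add_one_eq_two_mul_iff]
  refine and_congr_left fun _ => ⟨fun h => ⟨⟨lt_of_le_of_ne hp.1 ?_, hp.2⟩, h⟩, fun h => h.2⟩
  rintro rfl
  norm_num at h

/-- The centre of the stick as seen from its crossing point with the positive real ray. -/
def relCenter (p : ℝ) (x : ℂ) : ℂ := transl (-(p : ℂ)) x

theorem relCenter_im {p : ℝ} (x : ℂ) :
    (relCenter p x).im = (1 - p ^ 2) * x.im / ‖1 - p * x‖ ^ 2 := by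
  rw [relCenter, transl, Complex.div_im, Complex.sq_norm]
  simp [Complex.normSq_apply]
  ring

theorem hdist_ofReal {p : ℝ} (hp : |p| < 1) {x : ℂ} (hx : x ∈ disc) :
    hdist p x = 2 * Real.artanh |polarRad (relCenter p x)| := by
  rw [hdist_eq_artanh (ofReal_mem_disc.2 hp) hx, abs_polarRad, relCenter]

/-- The triple `(ρ', ϕ, r)` of a stick that crosses the positive real ray at `p` and has
centre `x`. -/
def coordAt (p : ℝ) (x : ℂ) : ℝ × ℝ × ℝ :=
  (2 * Real.artanh p, polarAng (relCenter p x), 2 * Real.artanh (polarRad (relCenter p x)))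

theorem artanh_neg_eq (x : ℝ) : Real.artanh (-x) = -Real.artanh x := by
  rw [Real.artanh, Real.artanh, ← Real.log_inv, ← Real.sqrt_inv, inv_div]
  congr 2
  ring

theorem abs_artanh (x : ℝ) : |Real.artanh x| = Real.artanh |x| := by
  rcases le_total 0 x with h | h
  · rw [abs_of_nonneg h, abs_of_nonneg (Real.artanh_nonneg h)]
  · rw [abs_of_nonpos h, artanh_neg_eq, abs_of_nonpos (Real.artanh_nonpos h)]

/-! ### Uniqueness of the triple -/

theorem transl_mem_geod {w z : ℂ} {θ : ℝ} (hw : w ∈ geod θ) (hz : z ∈ geod θ) :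
    transl w z ∈ geod θ := by
  have hmem := transl_mem_disc (geod_subset_disc _ hw) (geod_subset_disc _ hz)
  obtain ⟨u, -, rfl⟩ := hw
  obtain ⟨v, -, rfl⟩ := hz
  have h : transl (u * Complex.exp (θ * Complex.I)) (v * Complex.exp (θ * Complex.I)) =
      ((v + u) / (1 + u * v) : ℝ) * Complex.exp (θ * Complex.I) := by
    have h1 : Complex.exp (-(θ * Complex.I)) * Complex.exp (θ * Complex.I) = 1 := by
      rw [← Complex.exp_add, neg_add_cancel, Complex.exp_zero]
    rw [transl, map_mul, ← Complex.exp_conj, map_mul, Complex.conj_ofReal, Complex.conj_ofReal,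
      Complex.conj_I, mul_neg]
    have h2 : (u : ℂ) * Complex.exp (-(θ * Complex.I)) * (v * Complex.exp (θ * Complex.I)) =
        u * v := by linear_combination (u * v : ℂ) * h1
    rw [h2]
    push_cast
    ring
  rw [h] at hmem ⊢
  refine ⟨_, ?_, rfl⟩
  rw [← norm_ofReal_mul_exp _ θ]
  exact hmem

theorem relCenter_mem_disc {p : ℝ} (hp : |p| < 1) {x : ℂ} (hx : x ∈ disc) :
    relCenter p x ∈ disc :=
  transl_mem_disc (neg_mem_disc (ofReal_mem_disc.2 hp)) hx

theorem relCenter_im_ne_zero {p : ℝ} (hp : |p| < 1) {x : ℂ} (hx : x ∈ disc) (him : x.im ≠ 0) :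
    (relCenter p x).im ≠ 0 := by
  rw [relCenter_im]
  have h1 : 1 - p ^ 2 ≠ 0 := by
    have := (sq_lt_one_iff_abs_lt_one p).2 hp
    linarith
  have h2 := one_add_conj_mul_ne_zero (neg_mem_disc (ofReal_mem_disc.2 hp)) hx
  have h3 : 1 - (p : ℂ) * x ≠ 0 := by simpa [← sub_eq_add_neg] using h2
  positivity

/-- A stick lies on the geodesic through any of its real points `p ≠ x` and its centre `x`. -/
theorem stick_subset_image_geod {L φ p : ℝ} {x : ℂ} (hx : x ∈ disc) (him : x.im ≠ 0)
    (hp : |p| < 1) (hps : (p : ℂ) ∈ stick L x φ) :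
    stick L x φ ⊆ transl p '' geod (polarAng (relCenter p x)) := by
  have hp' := ofReal_mem_disc.2 hp
  have hw := relCenter_mem_disc hp hx
  have hwgeod : relCenter p x ∈ geod (polarAng (relCenter p x)) :=
    ⟨polarRad (relCenter p x), by rw [abs_polarRad]; exact hw, (polarRad_mul_exp _).symm⟩
  set w := relCenter p x with hwdef
  have hw0 : w ≠ 0 := fun h => relCenter_im_ne_zero hp hx him (by rw [← hwdef, h]; rfl)
  rintro _ ⟨z, ⟨hz, -⟩, rfl⟩
  obtain ⟨z₀, ⟨hz₀, -⟩, hpz⟩ := hps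
  have hzd := geod_subset_disc _ hz
  have hz₀d := geod_subset_disc _ hz₀
  refine ⟨_, ?_, transl_transl_neg hp' (transl_mem_disc hx hzd)⟩
  have hk := norm_one_add_div (neg_mem_disc hp') hx
  have e := transl_transl (neg_mem_disc hp') hx hzd
  have e₀ := transl_transl (neg_mem_disc hp') hx hz₀d
  rw [show transl (-(p : ℂ)) x = w from rfl] at e e₀
  set k := (1 + -(p : ℂ) * conj x) / (1 + conj (-(p : ℂ)) * x)
  have hkd : ∀ y ∈ disc, k * y ∈ disc := fun y hy => by
    change ‖_‖ < 1; rw [norm_mul, hk, one_mul]; exact hy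
  rw [e]
  refine transl_mem_geod hwgeod ?_
  -- The rotation `k` maps the direction of the stick to that of `w`, as it maps `z₀` to `-w`.
  have h0 : k * z₀ = -w := by
    rw [hpz] at e₀
    have h1 : transl w (k * z₀) = 0 := by
      rw [← e₀, transl, add_neg_cancel, zero_div]
    rw [transl, div_eq_zero_iff,
      or_iff_left (one_add_conj_mul_ne_zero hw (hkd _ hz₀d))] at h1
    linear_combination h1
  obtain ⟨s, -, rfl⟩ := hz
  obtain ⟨s₀, -, rfl⟩ := hz₀
  have hs₀ : (s₀ : ℂ) ≠ 0 := by
    intro h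
    rw [h, zero_mul, mul_zero, eq_comm, neg_eq_zero] at h0
    exact hw0 h0
  have h2 : k * (s * Complex.exp (((φ + x.arg : ℝ) : ℂ) * Complex.I)) =
      ((-(s * polarRad w / s₀) : ℝ) : ℂ) * Complex.exp (polarAng w * Complex.I) := by
    have h3 := polarRad_mul_exp w
    generalize Complex.exp (polarAng w * Complex.I) = E at h3 ⊢
    push_cast at h0 ⊢
    field_simp
    linear_combination (s : ℂ) * h0 + (s : ℂ) * h3
  have hmem := hkd _ hzd
  rw [h2] at hmem ⊢
  exact ⟨_, by rw [← norm_ofReal_mul_exp _ (polarAng w)]; exact hmem, rfl⟩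

/-- Off the real axis the triple of a stick is determined: the ray is crossed in one point at most,
and the signed polar coordinates of the relative centre are forced. -/
theorem isAltCoord_iff {L φ : ℝ} {x : ℂ} (hx : x ∈ disc) (him : x.im ≠ 0)
    (hφ : φ ∈ Ioo 0 Real.pi) (t : ℝ × ℝ × ℝ) :
    IsAltCoord L x φ t.1 t.2.1 t.2.2 ↔
      (1 < hitCoth x φ ∧ hdist (hitPoint x φ) x ≤ L / 2) ∧ t = coordAt (hitPoint x φ) x := by
  have hx0 : x ≠ 0 := by rintro rfl; exact him rfl
  constructor
  · obtain ⟨ρ, θ, r⟩ := t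
    rintro ⟨_, ⟨hps, p, h0, h1, rfl⟩, hρ, ⟨hθ, -⟩, hr, u, hu, hxu, hur⟩
    have hp : |p| < 1 := by rwa [abs_of_nonneg h0]
    obtain ⟨hK, rfl, hd⟩ := (ofReal_mem_stick_iff hx hx0 hφ ⟨h0, h1⟩).1 hps
    refine ⟨⟨hK, hd⟩, ?_⟩
    dsimp only at hρ hθ hr hxu hur
    set p := hitPoint x φ
    have hud : (u : ℂ) * Complex.exp (θ * Complex.I) ∈ disc := by
      change ‖_‖ < 1; rwa [norm_ofReal_mul_exp]
    have hw : relCenter p x = u * Complex.exp (θ * Complex.I) := by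
      conv_lhs => rw [hxu, relCenter, transl_neg_transl (ofReal_mem_disc.2 hp) hud]
    have hwim := relCenter_im_ne_zero hp hx him
    rw [hw, im_ofReal_mul_exp] at hwim
    have hu0 : u ≠ 0 := left_ne_zero_of_mul hwim
    have hθ' : θ ∈ Ioo 0 Real.pi := by
      refine ⟨lt_of_le_of_ne hθ.1 fun h => hwim ?_, hθ.2⟩
      rw [← h, Real.sin_zero, mul_zero]
    rw [hdist_zero_left (ofReal_mem_disc.2 hp), Complex.norm_real, Real.norm_eq_abs,
      abs_of_nonneg h0] at hρ
    rw [hdist_ofReal hp hx, hw, polarRad_ofReal_mul_exp hθ'] at hr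
    have hr' : r = 2 * Real.artanh u := by
      rcases lt_or_gt_of_ne hu0 with h | h
      · have := Real.artanh_neg (x := u) ⟨(abs_lt.1 hu).1, h⟩
        rw [← abs_artanh, abs_of_neg this, abs_of_nonpos (by nlinarith)] at hr
        linarith
      · have := Real.artanh_pos (x := u) ⟨h, (abs_lt.1 hu).2⟩
        rw [← abs_artanh, abs_of_pos this, abs_of_nonneg (by nlinarith)] at hr
        linarith
    rw [coordAt, hw, polarRad_ofReal_mul_exp hθ', polarAng_ofReal_mul_exp hu0 hθ', hρ, hr']
  · rintro ⟨⟨hK, hd⟩, rfl⟩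
    have hp01 := (sq_add_one_eq_two_mul_iff.2 ⟨hK, rfl⟩).1
    change hitPoint x φ ∈ _ at hp01
    have hps := (ofReal_mem_stick_iff (L := L) hx hx0 hφ (Ioo_subset_Ico_self hp01)).2
      ⟨hK, rfl, hd⟩
    set p := hitPoint x φ
    have hp : |p| < 1 := by rw [abs_of_pos hp01.1]; exact hp01.2
    have hw := relCenter_mem_disc hp hx
    have hang := polarAng_mem (relCenter_im_ne_zero hp hx him)
    have hu : |polarRad (relCenter p x)| < 1 := by rw [abs_polarRad]; exact hw
    refine ⟨p, ⟨hps, p, hp01.1.le, hp01.2, rfl⟩, ?_,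
      ⟨Ioo_subset_Ico_self hang, stick_subset_image_geod hx him hp hps⟩, ?_, ?_⟩
    · rw [hdist_zero_left (ofReal_mem_disc.2 hp), Complex.norm_real, Real.norm_eq_abs,
        abs_of_pos hp01.1, coordAt]
    · rw [hdist_ofReal hp hx, coordAt, abs_mul, abs_artanh, abs_two]
    · refine ⟨_, hu, ?_, ?_⟩
      · rw [coordAt, polarRad_mul_exp, relCenter, transl_transl_neg (ofReal_mem_disc.2 hp) hx]
      · rw [coordAt]
        rcases le_total 0 (polarRad (relCenter p x)) with h | h
        · have := Real.artanh_nonneg h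
          positivity
        · have := Real.artanh_nonpos h
          nlinarith

theorem mem_hitting_iff {L φ : ℝ} {x : ℂ} (hx : x ∈ disc) (him : x.im ≠ 0)
    (hφ : φ ∈ Ioo 0 Real.pi) :
    (x, φ) ∈ hitting L ↔ 1 < hitCoth x φ ∧ hdist (hitPoint x φ) x ≤ L / 2 := by
  have hx0 : x ≠ 0 := by rintro rfl; exact him rfl
  constructor
  · rintro ⟨-, -, _, hps, p, h0, h1, rfl⟩
    obtain ⟨hK, rfl, hd⟩ := (ofReal_mem_stick_iff hx hx0 hφ ⟨h0, h1⟩).1 hps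
    exact ⟨hK, hd⟩
  · intro h
    obtain ⟨p, hp, -⟩ := (isAltCoord_iff (L := L) hx him hφ _).2 ⟨h, rfl⟩
    exact ⟨hx, Ioo_subset_Ico_self hφ, p, hp⟩

/-! ### The substitution `r = 2 artanh u` -/

theorem hasDerivAt_artanh {u : ℝ} (hu : u ∈ Ioo (-1) 1) :
    HasDerivAt Real.artanh (1 / (1 - u ^ 2)) u := by
  have h1 : 0 < 1 + u := by linarith [hu.1]
  have h2 : 0 < 1 - u := by linarith [hu.2]
  have h3 : 1 - u ^ 2 ≠ 0 := by nlinarith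
  have h : HasDerivAt (fun u : ℝ => 1 / 2 * Real.log ((1 + u) / (1 - u))) (1 / (1 - u ^ 2)) u := by
    have h4 := ((((hasDerivAt_id' u).const_add 1).fun_div ((hasDerivAt_id' u).const_sub 1)
      h2.ne').log (div_pos h1 h2).ne').const_mul (1 / 2)
    refine h4.congr_deriv ?_
    field_simp
    ring
  refine h.congr_of_eventuallyEq ?_
  filter_upwards [isOpen_Ioo.mem_nhds hu] with v hv
  exact Real.artanh_eq_half_log (Ioo_subset_Icc_self hv)

theorem lintegral_image_two_mul_artanh {s : Set ℝ} (hs : MeasurableSet s) (hs' : s ⊆ Ioo (-1) 1)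
    (f : ℝ → ℝ≥0∞) :
    ∫⁻ r in (fun u => 2 * Real.artanh u) '' s, f r =
      ∫⁻ u in s, ENNReal.ofReal (2 / (1 - u ^ 2)) * f (2 * Real.artanh u) := by
  rw [lintegral_image_eq_lintegral_abs_deriv_mul hs
    (f' := fun u => 2 * (1 / (1 - u ^ 2)))
    (fun u hu => ((hasDerivAt_artanh (hs' hu)).const_mul 2).hasDerivWithinAt)
    (fun u hu v hv h => Real.artanh_injOn (hs' hu) (hs' hv) (mul_left_cancel₀ two_ne_zero h))]
  refine setLIntegral_congr_fun hs fun u hu => ?_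
  have : 0 < 1 - u ^ 2 := by nlinarith [(hs' hu).1, (hs' hu).2]
  rw [abs_of_pos (by positivity), mul_one_div]

theorem lintegral_two_mul_artanh (f : ℝ → ℝ≥0∞) :
    ∫⁻ u in Ioo (-1) 1, ENNReal.ofReal (2 / (1 - u ^ 2)) * f (2 * Real.artanh u) =
      ∫⁻ r, f r := by
  rw [← lintegral_image_two_mul_artanh measurableSet_Ioo subset_rfl]
  have himg : (fun u => 2 * Real.artanh u) '' Ioo (-1) 1 = univ := by
    refine eq_univ_of_forall fun r => ?_
    obtain ⟨u, hu, h⟩ := Real.artanh_surjOn (mem_univ (r / 2))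
    exact ⟨u, hu, by dsimp only; rw [h]; ring⟩
  rw [himg, setLIntegral_univ]

theorem lintegral_two_mul_artanh_Ioo_zero_one (f : ℝ → ℝ≥0∞) :
    ∫⁻ u in Ioo 0 1, ENNReal.ofReal (2 / (1 - u ^ 2)) * f (2 * Real.artanh u) =
      ∫⁻ r in Ioi 0, f r := by
  rw [← lintegral_image_two_mul_artanh measurableSet_Ioo
    (Ioo_subset_Ioo_left (by norm_num))]
  congr 2
  ext r
  constructor
  · rintro ⟨u, hu, rfl⟩
    exact mul_pos two_pos (Real.artanh_pos hu)
  · intro hr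
    obtain ⟨u, hu, h⟩ := Real.artanh_surjOn (mem_univ (r / 2))
    refine ⟨u, ⟨?_, hu.2⟩, by dsimp only; rw [h]; ring⟩
    by_contra! h0
    have := Real.artanh_nonpos h0
    rw [h] at this
    linarith [mem_Ioi.1 hr]

/-! ### Exchanging the angle for the crossing point -/

/-- The angle at which the stick with centre `x` must stand in order to cross the real ray at `p`;
its cotangent is the fraction below. -/
def hitAngle (x : ℂ) (p : ℝ) : ℝ :=
  Real.pi / 2 - Real.arctan
    ((‖x‖ ^ 2 * (1 + p ^ 2) - p * (x.re * (1 + ‖x‖ ^ 2))) / (p * (x.im * (1 - ‖x‖ ^ 2))))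

/-- The absolute value of the derivative, with respect to the crossing point `p`, of the angle of
the stick, for a fixed centre whose position relative to `p` is `w`. -/
def angDensity (p : ℝ) (w : ℂ) : ℝ :=
  (1 - ‖w‖ ^ 2) * |w.im| / ((1 - p ^ 2) * ‖w‖ ^ 2)

theorem hitAngle_mem (x : ℂ) (p : ℝ) : hitAngle x p ∈ Ioo 0 Real.pi := by
  have h1 := Real.neg_pi_div_two_lt_arctan
    ((‖x‖ ^ 2 * (1 + p ^ 2) - p * (x.re * (1 + ‖x‖ ^ 2))) / (p * (x.im * (1 - ‖x‖ ^ 2))))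
  have h2 := Real.arctan_lt_pi_div_two
    ((‖x‖ ^ 2 * (1 + p ^ 2) - p * (x.re * (1 + ‖x‖ ^ 2))) / (p * (x.im * (1 - ‖x‖ ^ 2))))
  constructor <;> unfold hitAngle <;> linarith

theorem sq_add_one_eq_hitCoth_hitAngle {x : ℂ} (hx : x ∈ disc) (him : x.im ≠ 0) {p : ℝ}
    (hp : p ≠ 0) : p ^ 2 + 1 = 2 * hitCoth x (hitAngle x p) * p := by
  have hx0 : x ≠ 0 := by rintro rfl; exact him rfl
  have h1 := (mem_disc_iff.1 hx).ne'
  rw [sq_add_one_eq_hitCoth_iff hx0 (Real.sin_pos_of_mem_Ioo (hitAngle_mem x p)).ne']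
  unfold hitAngle
  rw [Real.cos_pi_div_two_sub, Real.sin_pi_div_two_sub, Real.sin_arctan, Real.cos_arctan]
  field_simp

theorem hitPoint_hitAngle {x : ℂ} (hx : x ∈ disc) (him : x.im ≠ 0) {p : ℝ} (hp : p ∈ Ioo 0 1) :
    1 < hitCoth x (hitAngle x p) ∧ p = hitPoint x (hitAngle x p) :=
  sq_add_one_eq_two_mul_iff.1 ⟨hp, sq_add_one_eq_hitCoth_hitAngle hx him hp.1.ne'⟩

theorem hitAngle_hitPoint {x : ℂ} (hx : x ∈ disc) (him : x.im ≠ 0) {φ : ℝ}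
    (hφ : φ ∈ Ioo 0 Real.pi) (h : 1 < hitCoth x φ) :
    hitPoint x φ ∈ Ioo 0 1 ∧ hitAngle x (hitPoint x φ) = φ := by
  have hx0 : x ≠ 0 := by rintro rfl; exact him rfl
  have hs := Real.sin_pos_of_mem_Ioo hφ
  obtain ⟨hp, he⟩ := sq_add_one_eq_two_mul_iff.2 ⟨h, (rfl : hitPoint x φ = _)⟩
  refine ⟨hp, ?_⟩
  rw [sq_add_one_eq_hitCoth_iff hx0 hs.ne'] at he
  have h1 := (mem_disc_iff.1 hx).ne'
  have hp0 := hp.1.ne'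
  unfold hitAngle
  have e : (‖x‖ ^ 2 * (1 + hitPoint x φ ^ 2) - hitPoint x φ * (x.re * (1 + ‖x‖ ^ 2))) /
      (hitPoint x φ * (x.im * (1 - ‖x‖ ^ 2))) = Real.tan (Real.pi / 2 - φ) := by
    rw [Real.tan_eq_sin_div_cos, Real.sin_pi_div_two_sub, Real.cos_pi_div_two_sub,
      div_eq_div_iff (by positivity) hs.ne']
    linarith
  rw [e, Real.arctan_tan (by linarith [hφ.2]) (by linarith [hφ.1])]
  ring

/-- The cotangent of the angle is a quotient `A / B` with
`A ^ 2 + B ^ 2 = ‖x‖ ^ 2 * ‖x - p‖ ^ 2 * ‖1 - p * x‖ ^ 2`, from which the derivative follows; in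
terms of the relative centre it is `angDensity`. -/
theorem hasDerivAt_hitAngle {x : ℂ} (hx : x ∈ disc) (him : x.im ≠ 0) {p : ℝ} (hp : p ∈ Ioo 0 1) :
    ∃ d, HasDerivAt (hitAngle x) d p ∧ |d| = angDensity p (relCenter p x) := by
  have hp0 := hp.1.ne'
  have hp1 : |p| < 1 := by rw [abs_of_pos hp.1]; exact hp.2
  have hx1 := mem_disc_iff.1 hx
  have h2 := one_add_conj_mul_ne_zero (neg_mem_disc (ofReal_mem_disc.2 hp1)) hx
  have hD : 1 - (p : ℂ) * x ≠ 0 := by simpa [← sub_eq_add_neg] using h2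
  have hx0 : x ≠ 0 := by rintro rfl; exact him rfl
  have hxp : x - p ≠ 0 := fun h => him (by simpa using congrArg Complex.im h)
  have hx0' : ‖x‖ ^ 2 ≠ 0 := by positivity
  have hp2 : 0 < 1 - p ^ 2 := by nlinarith [hp.1, hp.2]
  have hden : p * (x.im * (1 - ‖x‖ ^ 2)) ≠ 0 := by
    have := hx1.ne'
    positivity
  have hN : HasDerivAt (fun p : ℝ => ‖x‖ ^ 2 * (1 + p ^ 2) - p * (x.re * (1 + ‖x‖ ^ 2)))
      (‖x‖ ^ 2 * (2 * p) - 1 * (x.re * (1 + ‖x‖ ^ 2))) p := by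
    refine HasDerivAt.sub (HasDerivAt.const_mul _ ?_) ((hasDerivAt_id p).mul_const _)
    simpa using (hasDerivAt_pow 2 p).const_add 1
  have hM : HasDerivAt (fun p : ℝ => p * (x.im * (1 - ‖x‖ ^ 2)))
      (1 * (x.im * (1 - ‖x‖ ^ 2))) p := (hasDerivAt_id p).mul_const _
  have h := ((hN.fun_div hM hden).arctan).const_sub (Real.pi / 2)
  refine ⟨_, h, ?_⟩
  have hsum : (p * (x.im * (1 - ‖x‖ ^ 2))) ^ 2 +
      (‖x‖ ^ 2 * (1 + p ^ 2) - p * (x.re * (1 + ‖x‖ ^ 2))) ^ 2 =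
      ‖x‖ ^ 2 * (‖x - p‖ ^ 2 * ‖1 - p * x‖ ^ 2) := by
    simp only [Complex.sq_norm, Complex.normSq_apply]
    simp
    ring
  have hval : |x.im| * ((1 - ‖x‖ ^ 2) * (1 - p ^ 2) / (‖x - p‖ ^ 2 * ‖1 - p * x‖ ^ 2)) =
      angDensity p (relCenter p x) := by
    have e1 : 1 - ‖relCenter p x‖ ^ 2 =
        (1 - p ^ 2) * (1 - ‖x‖ ^ 2) / ‖1 - p * x‖ ^ 2 := by
      rw [relCenter, one_sub_normSq_transl (neg_mem_disc (ofReal_mem_disc.2 hp1)) hx]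
      simp [← sub_eq_add_neg]
    have e2 : ‖relCenter p x‖ ^ 2 = ‖x - p‖ ^ 2 / ‖1 - p * x‖ ^ 2 := by
      rw [relCenter, transl, norm_div, div_pow]
      simp [← sub_eq_add_neg]
    have hD' : 0 < ‖1 - p * x‖ ^ 2 := by positivity
    rw [angDensity, e1, e2, relCenter_im, abs_div, abs_mul, abs_of_pos hp2, abs_of_pos hD']
    field_simp
  have hA : ∀ A B C : ℝ, B ≠ 0 →
      1 / (1 + (A / B) ^ 2) * (C / B ^ 2) = C / (B ^ 2 + A ^ 2) := by
    intro A B C hB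
    field_simp
  rw [hA _ _ _ hden, hsum, ← hval, abs_neg]
  have e3 : (‖x‖ ^ 2 * (2 * p) - 1 * (x.re * (1 + ‖x‖ ^ 2))) * (p * (x.im * (1 - ‖x‖ ^ 2))) -
      (‖x‖ ^ 2 * (1 + p ^ 2) - p * (x.re * (1 + ‖x‖ ^ 2))) * (1 * (x.im * (1 - ‖x‖ ^ 2))) =
      ‖x‖ ^ 2 * (-x.im * ((1 - ‖x‖ ^ 2) * (1 - p ^ 2))) := by ring
  rw [e3, mul_div_mul_left _ _ hx0', mul_div_assoc, abs_mul, abs_neg]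
  congr 1
  exact abs_of_nonneg (by positivity)

/-- For a fixed centre, the angles of the sticks that cross the ray are parametrized by the crossing
point. -/
theorem setLIntegral_hitPoint {x : ℂ} (hx : x ∈ disc) (him : x.im ≠ 0) (G : ℝ → ℝ≥0∞) :
    ∫⁻ φ in {φ | φ ∈ Ioo 0 Real.pi ∧ 1 < hitCoth x φ}, G (hitPoint x φ) =
      ∫⁻ p in Ioo 0 1, ENNReal.ofReal (angDensity p (relCenter p x)) * G p := by
  have himg : {φ | φ ∈ Ioo 0 Real.pi ∧ 1 < hitCoth x φ} = hitAngle x '' Ioo 0 1 := by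
    ext φ
    constructor
    · rintro ⟨h1, h2⟩
      exact ⟨_, (hitAngle_hitPoint hx him h1 h2).1, (hitAngle_hitPoint hx him h1 h2).2⟩
    · rintro ⟨p, hp, rfl⟩
      exact ⟨hitAngle_mem x p, (hitPoint_hitAngle hx him hp).1⟩
  choose! d hd hd' using fun p (hp : p ∈ Ioo (0 : ℝ) 1) => hasDerivAt_hitAngle hx him hp
  rw [himg, lintegral_image_eq_lintegral_abs_deriv_mul measurableSet_Ioo
    (fun p hp => (hd p hp).hasDerivWithinAt)
    (LeftInvOn.injOn (f₁' := hitPoint x) fun p hp => (hitPoint_hitAngle hx him hp).2.symm)]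
  refine setLIntegral_congr_fun measurableSet_Ioo fun p hp => ?_
  rw [hd' p hp, ← (hitPoint_hitAngle hx him hp).2]

/-! ### Invariance of the hyperbolic area -/

theorem measurableSet_disc : MeasurableSet disc :=
  (isOpen_lt continuous_norm continuous_const).measurableSet

theorem measurable_transl (p : ℂ) : Measurable (transl p) := by
  unfold transl; fun_prop

theorem measurable_hypArea_density :
    Measurable fun z : ℂ => ENNReal.ofReal (4 / (1 - ‖z‖ ^ 2) ^ 2) := by fun_prop

theorem lintegral_hypArea {f : ℂ → ℝ≥0∞} (hf : Measurable f) :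
    ∫⁻ z, f z ∂hypArea = ∫⁻ z in disc, ENNReal.ofReal (4 / (1 - ‖z‖ ^ 2) ^ 2) * f z := by
  rw [hypArea, lintegral_withDensity_eq_lintegral_mul _ measurable_hypArea_density hf]
  rfl

theorem hasDerivAt_transl {p z : ℂ} (hp : p ∈ disc) (hz : z ∈ disc) :
    HasDerivAt (transl p) ((1 - ‖p‖ ^ 2 : ℝ) / (1 + conj p * z) ^ 2) z := by
  have h := one_add_conj_mul_ne_zero hp hz
  refine (((hasDerivAt_id' z).add_const p).fun_div
    (((hasDerivAt_id' z).const_mul (conj p)).const_add 1) h).congr_deriv ?_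
  have : (‖p‖ : ℂ) ^ 2 = p * conj p := by
    rw [Complex.mul_conj, Complex.normSq_eq_norm_sq]; push_cast; rfl
  push_cast
  rw [this]
  ring

/-- The hyperbolic area is invariant under translations. -/
theorem lintegral_hypArea_transl_neg {p : ℂ} (hp : p ∈ disc) {f : ℂ → ℝ≥0∞} (hf : Measurable f) :
    ∫⁻ z, f (transl (-p) z) ∂hypArea = ∫⁻ w, f w ∂hypArea := by
  rw [lintegral_hypArea (f := fun z => f (transl (-p) z))
    (hf.comp (measurable_transl _)), lintegral_hypArea hf]
  have himg : transl p '' disc = disc := by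
    ext z
    constructor
    · rintro ⟨w, hw, rfl⟩
      exact transl_mem_disc hp hw
    · intro hz
      exact ⟨_, transl_mem_disc (neg_mem_disc hp) hz, transl_transl_neg hp hz⟩
  conv_lhs => rw [← himg]
  rw [lintegral_image_eq_lintegral_abs_det_fderiv_mul volume measurableSet_disc
    (fun w hw => ((hasDerivAt_transl hp hw).hasFDerivAt.restrictScalars ℝ).hasFDerivWithinAt)
    (LeftInvOn.injOn (f₁' := transl (-p)) fun w hw => transl_neg_transl hp hw)]
  refine setLIntegral_congr_fun measurableSet_disc fun w hw => ?_
  rw [transl_neg_transl hp hw, ← mul_assoc, ← ENNReal.ofReal_mul (abs_nonneg _)]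
  congr 2
  have hdet : ∀ c : ℂ, (ContinuousLinearMap.restrictScalars ℝ
      (ContinuousLinearMap.toSpanSingleton ℂ c)).det = ‖c‖ ^ 2 := by
    intro c
    simp [ContinuousLinearMap.det, LinearMap.det_restrictScalars, Algebra.norm_complex_eq,
      Complex.normSq_eq_norm_sq]
  rw [hdet, one_sub_normSq_transl hp hw, abs_of_nonneg (by positivity), norm_div, norm_pow,
    Complex.norm_real, Real.norm_eq_abs, abs_of_pos (mem_disc_iff.1 hp)]
  have h1 := (mem_disc_iff.1 hp).ne'
  have h2 := (mem_disc_iff.1 hw).ne'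
  have h3 := norm_ne_zero_iff.2 (one_add_conj_mul_ne_zero hp hw)
  field_simp

/-! ### Integration in signed hyperbolic polar coordinates -/

/-- Integration in signed polar coordinates, with a radius in `ℝ` and an angle in `(0, π)`. -/
theorem lintegral_signed_polar {g : ℂ → ℝ≥0∞} (hg : Measurable g) :
    ∫⁻ w, g w = ∫⁻ u : ℝ, ∫⁻ θ in Ioo 0 Real.pi,
      ENNReal.ofReal |u| * g (u * Complex.exp (θ * Complex.I)) := by
  let F : ℝ → ℝ → ℝ≥0∞ := fun u θ => ENNReal.ofReal |u| * g (u * Complex.exp (θ * Complex.I))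
  have hF : Measurable (Function.uncurry F) := by
    unfold F Function.uncurry; fun_prop
  -- The lower half plane is the upper one with the sign of the radius reversed.
  have hshift : ∀ u : ℝ, ∫⁻ θ in Ioo (-Real.pi) 0, F u θ = ∫⁻ θ in Ioo 0 Real.pi, F (-u) θ := by
    intro u
    rw [← lintegral_indicator measurableSet_Ioo, ← lintegral_indicator measurableSet_Ioo,
      ← lintegral_sub_right_eq_self _ Real.pi]
    congr 1
    ext θ
    have hmem : θ - Real.pi ∈ Ioo (-Real.pi) 0 ↔ θ ∈ Ioo 0 Real.pi := by
      constructor <;> rintro ⟨h1, h2⟩ <;> constructor <;> linarith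
    by_cases h : θ ∈ Ioo 0 Real.pi
    · rw [indicator_of_mem h, indicator_of_mem (hmem.2 h)]
      simp only [F, abs_neg]
      congr 2
      push_cast
      rw [sub_mul, Complex.exp_sub, Complex.exp_pi_mul_I]
      ring
    · rw [indicator_of_notMem h, indicator_of_notMem (mt hmem.1 h)]
  have hsplit : ∀ u : ℝ, ∫⁻ θ in Ioo (-Real.pi) Real.pi, F u θ =
      (∫⁻ θ in Ioo 0 Real.pi, F (-u) θ) + ∫⁻ θ in Ioo 0 Real.pi, F u θ := by
    intro u
    rw [← hshift, setLIntegral_congr (Ioo_ae_eq_Ioc (a := -Real.pi) (b := 0)),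
      ← Ioc_union_Ioo_eq_Ioo (neg_nonpos.2 Real.pi_pos.le) Real.pi_pos,
      lintegral_union measurableSet_Ioo
        (disjoint_left.2 fun x h1 h2 => absurd h1.2 (not_le.2 h2.1))]
  have hH : Measurable fun u => ∫⁻ θ in Ioo 0 Real.pi, F u θ := hF.lintegral_prod_right'
  calc ∫⁻ w, g w = ∫⁻ p in Ioi (0 : ℝ) ×ˢ Ioo (-Real.pi) Real.pi, F p.1 p.2 := by
        rw [← Complex.lintegral_comp_polarCoord_symm]
        refine setLIntegral_congr_fun (measurableSet_Ioi.prod measurableSet_Ioo) fun p hp => ?_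
        simp only [F, Complex.polarCoord_symm_apply, smul_eq_mul]
        rw [abs_of_pos (mem_Ioi.1 hp.1), Complex.exp_mul_I, Complex.ofReal_cos, Complex.ofReal_sin]
    _ = ∫⁻ u in Ioi 0, ∫⁻ θ in Ioo (-Real.pi) Real.pi, F u θ := by
        rw [Measure.volume_eq_prod, ← Measure.prod_restrict]
        exact lintegral_prod (fun p : ℝ × ℝ => F p.1 p.2) hF.aemeasurable
    _ = (∫⁻ u in Ioi 0, ∫⁻ θ in Ioo 0 Real.pi, F (-u) θ) +
          ∫⁻ u in Ioi 0, ∫⁻ θ in Ioo 0 Real.pi, F u θ := by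
        simp_rw [hsplit]
        exact lintegral_add_left (hH.comp measurable_neg) _
    _ = (∫⁻ u in Iic 0, ∫⁻ θ in Ioo 0 Real.pi, F u θ) +
          ∫⁻ u in Ioi 0, ∫⁻ θ in Ioo 0 Real.pi, F u θ := by
        congr 1
        rw [setLIntegral_congr Iio_ae_eq_Iic.symm, ← lintegral_indicator measurableSet_Ioi,
          ← lintegral_indicator measurableSet_Iio, ← lintegral_neg_eq_self]
        congr 1
        ext u
        simp only [indicator, mem_Ioi, mem_Iio, neg_neg, Left.neg_pos_iff]
    _ = ∫⁻ u : ℝ, ∫⁻ θ in Ioo 0 Real.pi, F u θ := by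
        rw [← compl_Iic, lintegral_add_compl _ measurableSet_Iic]

/-! ### Measurability -/

theorem measurable_polarRad : Measurable polarRad :=
  Measurable.ite (measurableSet_le measurable_const Complex.measurable_im) measurable_norm
    measurable_norm.neg

theorem measurable_polarAng : Measurable polarAng :=
  Measurable.ite (measurableSet_le measurable_const Complex.measurable_im) Complex.measurable_arg
    (Complex.measurable_arg.add_const _)

theorem measurable_artanh : Measurable Real.artanh := by
  unfold Real.artanh; fun_prop

theorem measurable_hitCoth : Measurable fun q : ℂ × ℝ => hitCoth q.1 q.2 := by
  unfold hitCoth; fun_prop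

theorem measurable_hitPoint : Measurable fun q : ℂ × ℝ => hitPoint q.1 q.2 := by
  have := measurable_hitCoth
  unfold hitPoint; fun_prop

theorem measurable_relCenter : Measurable fun q : ℝ × ℂ => relCenter q.1 q.2 := by
  unfold relCenter transl; fun_prop

theorem measurable_angDensity : Measurable fun q : ℝ × ℂ => angDensity q.1 q.2 := by
  unfold angDensity; fun_prop

theorem measurable_coordAt : Measurable fun q : ℝ × ℂ => coordAt q.1 q.2 := by
  have := measurable_relCenter
  have := measurable_polarRad
  have := measurable_polarAng
  have := measurable_artanh
  unfold coordAt; fun_prop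

/-! ### The density of the relative centre -/

/-- For sticks seen from their crossing point `p`, the density of the centre `w` becomes a product
in signed hyperbolic polar coordinates. -/
theorem lintegral_hypArea_angDensity {p : ℝ} (hp : p ∈ Ioo 0 1) {f : ℝ → ℝ → ℝ≥0∞}
    (hf : Measurable (Function.uncurry f)) :
    ∫⁻ w, ENNReal.ofReal (angDensity p w) * f (polarAng w) (2 * Real.artanh (polarRad w))
        ∂hypArea =
      ENNReal.ofReal (2 / (1 - p ^ 2)) *
        ∫⁻ r, ∫⁻ θ in Ioo 0 Real.pi, ENNReal.ofReal (Real.sin θ) * f θ r := by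
  have hp2 : 0 < 1 - p ^ 2 := by nlinarith [hp.1, hp.2]
  have h1 := measurable_angDensity
  have h2 := measurable_polarRad
  have h3 := measurable_polarAng
  have h4 := measurable_artanh
  have hm : Measurable fun w : ℂ => ENNReal.ofReal (angDensity p w) *
      f (polarAng w) (2 * Real.artanh (polarRad w)) := by
    have h5 : Measurable fun w : ℂ => f (polarAng w) (2 * Real.artanh (polarRad w)) :=
      hf.comp (h3.prodMk ((h4.comp h2).const_mul 2))
    exact (h1.comp measurable_prodMk_left).ennreal_ofReal.mul h5
  have hfr : Measurable fun r : ℝ =>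
      ∫⁻ θ in Ioo 0 Real.pi, ENNReal.ofReal (Real.sin θ) * f θ r := by
    refine Measurable.lintegral_prod_right' (f := fun q : ℝ × ℝ =>
      ENNReal.ofReal (Real.sin q.2) * f q.2 q.1) ?_
    exact (by fun_prop : Measurable fun q : ℝ × ℝ => ENNReal.ofReal (Real.sin q.2)).mul
      (hf.comp measurable_swap)
  rw [lintegral_hypArea hm, ← lintegral_indicator measurableSet_disc,
    lintegral_signed_polar
      ((measurable_hypArea_density.fun_mul hm).indicator measurableSet_disc),
    ← lintegral_two_mul_artanh (fun r =>
      ∫⁻ θ in Ioo 0 Real.pi, ENNReal.ofReal (Real.sin θ) * f θ r),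
    ← lintegral_indicator measurableSet_Ioo, ← lintegral_const_mul]
  · refine lintegral_congr_ae ?_
    filter_upwards [Measure.ae_ne volume (0 : ℝ)] with u hu0
    by_cases hu : u ∈ Ioo (-1 : ℝ) 1
    · rw [indicator_of_mem hu]
      have hu2 : 0 < 1 - u ^ 2 := by nlinarith [hu.1, hu.2]
      rw [← lintegral_const_mul' _ _ ENNReal.ofReal_ne_top,
        ← lintegral_const_mul' _ _ ENNReal.ofReal_ne_top]
      refine setLIntegral_congr_fun measurableSet_Ioo fun θ hθ => ?_
      have hs := Real.sin_pos_of_mem_Ioo hθ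
      have hmem : (u : ℂ) * Complex.exp (θ * Complex.I) ∈ disc := by
        change ‖_‖ < 1
        rw [norm_ofReal_mul_exp]
        exact abs_lt.2 hu
      rw [indicator_of_mem hmem, polarAng_ofReal_mul_exp hu0 hθ, polarRad_ofReal_mul_exp hθ,
        ← mul_assoc, ← mul_assoc, ← mul_assoc, ← mul_assoc, ← ENNReal.ofReal_mul (by positivity),
        ← ENNReal.ofReal_mul (by positivity), ← ENNReal.ofReal_mul (by positivity),
        ← ENNReal.ofReal_mul (by positivity)]
      congr 2
      rw [angDensity, norm_ofReal_mul_exp, im_ofReal_mul_exp, abs_mul, abs_of_pos hs, sq_abs]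
      have : |u| * |u| = u ^ 2 := by rw [abs_mul_abs_self, sq]
      field_simp
      linear_combination 4 * this
    · rw [indicator_of_notMem hu, mul_zero]
      have hmem : ∀ θ : ℝ, (u : ℂ) * Complex.exp (θ * Complex.I) ∉ disc := by
        intro θ h
        change ‖_‖ < 1 at h
        rw [norm_ofReal_mul_exp] at h
        exact hu (abs_lt.1 h)
      simp [indicator_of_notMem (hmem _)]
  · refine Measurable.indicator ?_ measurableSet_Ioo
    exact (by fun_prop : Measurable fun u : ℝ => ENNReal.ofReal (2 / (1 - u ^ 2))).mul
      (hfr.comp (h4.const_mul 2))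

/-! ### The measure of the sticks that hit the ray -/

/-- A measurable version of `hitting L`, which leaves out the centres on the real axis and the angle
`0`, for which the stick points at the origin. -/
def hitSet (L : ℝ) : Set (ℂ × ℝ) :=
  {q | (q.1 ∈ disc ∧ q.1.im ≠ 0 ∧ q.2 ∈ Ioo 0 Real.pi) ∧ 1 < hitCoth q.1 q.2 ∧
    |2 * Real.artanh (polarRad (relCenter (hitPoint q.1 q.2) q.1))| ≤ L / 2}

theorem measurableSet_hitSet (L : ℝ) : MeasurableSet (hitSet L) := by
  have h1 := measurable_hitCoth
  have h2 : Measurable fun q : ℂ × ℝ =>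
      |2 * Real.artanh (polarRad (relCenter (hitPoint q.1 q.2) q.1))| :=
    ((measurable_artanh.comp (measurable_polarRad.comp (measurable_relCenter.comp
      (measurable_hitPoint.prodMk measurable_fst)))).const_mul 2).abs
  refine MeasurableSet.inter (MeasurableSet.inter (measurable_fst measurableSet_disc) ?_)
    ((measurableSet_lt measurable_const h1).inter (measurableSet_le h2 measurable_const))
  exact MeasurableSet.inter ((Complex.measurable_im.comp measurable_fst)
    (measurableSet_singleton 0).compl) (measurable_snd measurableSet_Ioo)

instance : SFinite hypArea := by unfold hypArea; infer_instance

instance : SFinite unifAngle := by unfold unifAngle; infer_instance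

theorem ae_im_ne_zero : ∀ᵐ z : ℂ, z.im ≠ 0 := by
  have h := (Complex.volume_preserving_equiv_real_prod).quasiMeasurePreserving.ae
    (p := fun q : ℝ × ℝ => q.2 ≠ 0)
    (Measure.quasiMeasurePreserving_snd.ae (Measure.ae_ne volume (0 : ℝ)))
  exact h

theorem ae_hypArea : ∀ᵐ z ∂hypArea, z ∈ disc ∧ z.im ≠ 0 := by
  refine (withDensity_absolutelyContinuous _ _).ae_le ?_
  filter_upwards [ae_restrict_mem measurableSet_disc, ae_restrict_of_ae ae_im_ne_zero] with z h1 h2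
  exact ⟨h1, h2⟩

theorem ae_unifAngle : ∀ᵐ φ ∂unifAngle, φ ∈ Ioo 0 Real.pi := by
  refine Measure.ae_smul_measure ?_ _
  filter_upwards [ae_restrict_mem measurableSet_Ico,
    ae_restrict_of_ae (Measure.ae_ne volume (0 : ℝ))] with φ h1 h2
  exact ⟨lt_of_le_of_ne h1.1 (Ne.symm h2), h1.2⟩

theorem ae_stickMeasure :
    ∀ᵐ q ∂stickMeasure, q.1 ∈ disc ∧ q.1.im ≠ 0 ∧ q.2 ∈ Ioo 0 Real.pi := by
  filter_upwards [Measure.quasiMeasurePreserving_fst.ae ae_hypArea,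
    Measure.quasiMeasurePreserving_snd.ae ae_unifAngle] with q h1 h2
  exact ⟨h1.1, h1.2, h2⟩

theorem hdist_hitPoint {x : ℂ} {φ : ℝ} (hx : x ∈ disc) (h : 1 < hitCoth x φ) :
    hdist (hitPoint x φ) x = |2 * Real.artanh (polarRad (relCenter (hitPoint x φ) x))| := by
  have hp := (sq_add_one_eq_two_mul_iff.2 ⟨h, (rfl : hitPoint x φ = _)⟩).1
  rw [hdist_ofReal (by rw [abs_of_pos hp.1]; exact hp.2) hx, abs_mul, abs_two, abs_artanh]

theorem hitting_ae_eq (L : ℝ) : hitting L =ᵐ[stickMeasure] hitSet L := by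
  filter_upwards [ae_stickMeasure] with q hq
  refine propext ?_
  change q ∈ hitting L ↔ q ∈ hitSet L
  have h1 := mem_hitting_iff (L := L) hq.1 hq.2.1 hq.2.2
  rw [show q = (q.1, q.2) from rfl, h1]
  constructor
  · intro h
    exact ⟨hq, h.1, (hdist_hitPoint hq.1 h.1).symm.trans_le h.2⟩
  · intro h
    exact ⟨h.2.1, (hdist_hitPoint hq.1 h.2.1).trans_le h.2.2⟩

theorem isAltCoord_iff_of_mem_hitSet {L : ℝ} {q : ℂ × ℝ} (hq : q ∈ hitSet L) (t : ℝ × ℝ × ℝ) :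
    IsAltCoord L q.1 q.2 t.1 t.2.1 t.2.2 ↔ t = coordAt (hitPoint q.1 q.2) q.1 := by
  rw [isAltCoord_iff hq.1.1 hq.1.2.1 hq.1.2.2, and_iff_right]
  exact ⟨hq.2.1, (hdist_hitPoint hq.1.1 hq.2.1).trans_le hq.2.2⟩

theorem altCoord_of_mem_hitSet {L : ℝ} {q : ℂ × ℝ} (hq : q ∈ hitSet L) :
    altCoord L q = coordAt (hitPoint q.1 q.2) q.1 :=
  (isAltCoord_iff_of_mem_hitSet hq _).1
    (Classical.epsilon_spec (p := fun t : ℝ × ℝ × ℝ => IsAltCoord L q.1 q.2 t.1 t.2.1 t.2.2)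
      ⟨_, (isAltCoord_iff_of_mem_hitSet hq _).2 rfl⟩)

theorem measurable_coordAt_hitPoint :
    Measurable fun q : ℂ × ℝ => coordAt (hitPoint q.1 q.2) q.1 :=
  measurable_coordAt.comp (measurable_hitPoint.prodMk measurable_fst)

theorem lintegral_altMeasure (L : ℝ) {f : ℝ × ℝ × ℝ → ℝ≥0∞} (hf : Measurable f) :
    ∫⁻ t, f t ∂altMeasure L = ENNReal.ofReal (1 / Real.pi) * ∫⁻ ρ in Ioi 0, ∫⁻ r,
      ∫⁻ θ in Ioo 0 Real.pi, ENNReal.ofReal (Real.sin θ) *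
        {r | |r| ≤ L / 2}.indicator (fun r => f (ρ, θ, r)) r := by
  have hset : {r : ℝ | |r| ≤ L / 2} = Icc (-L / 2) (L / 2) := by
    ext r; rw [mem_ofPred_eq, abs_le, mem_Icc, neg_div]
  have hind : Measurable fun q : ℝ × ℝ × ℝ =>
      (Icc (-L / 2) (L / 2)).indicator (fun r => f (q.1, q.2.1, r)) q.2.2 :=
    hf.indicator (s := {q : ℝ × ℝ × ℝ | q.2.2 ∈ Icc (-L / 2) (L / 2)})
      (measurable_snd.comp measurable_snd measurableSet_Icc)
  rw [altMeasure, lintegral_prod _ hf.aemeasurable, lintegral_smul_measure, smul_eq_mul,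
    setLIntegral_congr Ioi_ae_eq_Ici.symm, hset]
  congr 1
  refine setLIntegral_congr_fun measurableSet_Ioi fun ρ _ => ?_
  have hfρ : Measurable fun q : ℝ × ℝ => f (ρ, q) := hf.comp measurable_prodMk_left
  have hindρ : Measurable fun q : ℝ × ℝ =>
      (Icc (-L / 2) (L / 2)).indicator (fun r => f (ρ, q.1, r)) q.2 :=
    hind.comp measurable_prodMk_left
  have hsin : Measurable fun θ : ℝ => ENNReal.ofReal (Real.sin θ) := by fun_prop
  rw [lintegral_prod _ hfρ.aemeasurable, lintegral_withDensity_eq_lintegral_mul _ hsin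
    hfρ.lintegral_prod_right', setLIntegral_congr Ioo_ae_eq_Ico.symm, lintegral_lintegral_swap]
  · refine lintegral_congr fun θ => ?_
    rw [lintegral_const_mul' _ _ ENNReal.ofReal_ne_top, lintegral_indicator measurableSet_Icc]
    rfl
  · exact ((hsin.comp measurable_snd).mul (hindρ.comp measurable_swap)).aemeasurable

/-- For a fixed centre `x`, the integral over the angle becomes an integral over the crossing
point. -/
theorem lintegral_unifAngle_hitSet (L : ℝ) {x : ℂ} (hx : x ∈ disc) (him : x.im ≠ 0)
    (f : ℝ × ℝ × ℝ → ℝ≥0∞) :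
    ∫⁻ φ, (hitSet L).indicator (fun q => f (coordAt (hitPoint q.1 q.2) q.1)) (x, φ) ∂unifAngle =
      ENNReal.ofReal (1 / Real.pi) * ∫⁻ p in Ioo 0 1,
        ENNReal.ofReal (angDensity p (relCenter p x)) *
          {t : ℝ × ℝ × ℝ | |t.2.2| ≤ L / 2}.indicator f (coordAt p x) := by
  have hS : MeasurableSet {φ | φ ∈ Ioo 0 Real.pi ∧ 1 < hitCoth x φ} :=
    measurableSet_Ioo.inter (measurableSet_lt measurable_const
      (measurable_hitCoth.comp measurable_prodMk_left))
  rw [unifAngle, lintegral_smul_measure, smul_eq_mul, ← setLIntegral_hitPoint hx him,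
    setLIntegral_congr Ioo_ae_eq_Ico.symm, ← lintegral_indicator measurableSet_Ioo,
    ← lintegral_indicator hS]
  congr 1
  refine lintegral_congr fun φ => ?_
  by_cases h : φ ∈ {φ | φ ∈ Ioo 0 Real.pi ∧ 1 < hitCoth x φ}
  · rw [indicator_of_mem h, indicator_of_mem h.1]
    by_cases h' : coordAt (hitPoint x φ) x ∈ {t : ℝ × ℝ × ℝ | |t.2.2| ≤ L / 2}
    · rw [indicator_of_mem h', indicator_of_mem (show (x, φ) ∈ hitSet L from
        ⟨⟨hx, him, h.1⟩, h.2, h'⟩)]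
    · rw [indicator_of_notMem h', indicator_of_notMem (show (x, φ) ∉ hitSet L from
        fun hq => h' hq.2.2)]
  · rw [indicator_of_notMem h, indicator_apply_eq_zero]
    exact fun _ => indicator_of_notMem (fun hq => h ⟨hq.1.2.2, hq.2.1⟩) _

/-- The change of variables from `(x, φ)` to `(ρ', ϕ, r)`, in integrated form. -/
theorem lintegral_coordAt_hitSet (L : ℝ) {f : ℝ × ℝ × ℝ → ℝ≥0∞} (hf : Measurable f) :
    ∫⁻ q in hitSet L, f (coordAt (hitPoint q.1 q.2) q.1) ∂stickMeasure =
      ∫⁻ t, f t ∂altMeasure L := by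
  have hF : Measurable ({t : ℝ × ℝ × ℝ | |t.2.2| ≤ L / 2}.indicator f) :=
    hf.indicator (measurableSet_le (by fun_prop) measurable_const)
  have hinner : ∀ᵐ x ∂hypArea, _ := ae_hypArea.mono fun x hx =>
    lintegral_unifAngle_hitSet L hx.1 hx.2 f
  have hind : Measurable ((hitSet L).indicator fun q => f (coordAt (hitPoint q.1 q.2) q.1)) :=
    (hf.comp measurable_coordAt_hitPoint).indicator (measurableSet_hitSet L)
  have hrhs := lintegral_altMeasure L hf
  rw [← lintegral_indicator (measurableSet_hitSet L), stickMeasure,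
    lintegral_prod _ hind.aemeasurable, lintegral_congr_ae hinner,
    lintegral_const_mul' _ _ ENNReal.ofReal_ne_top, hrhs,
    ← lintegral_two_mul_artanh_Ioo_zero_one]
  generalize hFdef : {t : ℝ × ℝ × ℝ | |t.2.2| ≤ L / 2}.indicator f = F at hF ⊢
  have hFr : ∀ ρ θ r, {r | |r| ≤ L / 2}.indicator (fun r => f (ρ, θ, r)) r = F (ρ, θ, r) :=
    fun ρ θ r => by rw [← hFdef]; rfl
  simp_rw [hFr]
  have hG : Measurable fun q : ℝ × ℂ => ENNReal.ofReal (angDensity q.1 q.2) *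
      F (2 * Real.artanh q.1, polarAng q.2, 2 * Real.artanh (polarRad q.2)) := by
    have h1 := measurable_artanh
    have h2 := measurable_polarRad
    have h3 := measurable_polarAng
    have h4 := measurable_angDensity
    fun_prop
  have hGrel : Measurable fun q : ℂ × ℝ => ENNReal.ofReal (angDensity q.2 (relCenter q.2 q.1)) *
      F (coordAt q.2 q.1) :=
    (measurable_angDensity.comp (measurable_snd.prodMk (measurable_relCenter.comp
      measurable_swap))).ennreal_ofReal.fun_mul (hF.comp (measurable_coordAt.comp measurable_swap))
  -- From here on the crossing point is fixed and the centre varies.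
  rw [lintegral_lintegral_swap hGrel.aemeasurable]
  congr 1
  refine setLIntegral_congr_fun measurableSet_Ioo fun p hp => ?_
  have hp1 : |p| < 1 := by rw [abs_of_pos hp.1]; exact hp.2
  refine Eq.trans ?_ (lintegral_hypArea_angDensity hp (f := fun θ r => F (2 * Real.artanh p, θ, r))
    (hF.comp measurable_prodMk_left))
  exact lintegral_hypArea_transl_neg (ofReal_mem_disc.2 hp1) (hG.comp measurable_prodMk_left)

theorem ae_restrict_hitting_mem_hitSet (L : ℝ) :
    ∀ᵐ q ∂stickMeasure.restrict (hitting L), q ∈ hitSet L := by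
  rw [Measure.restrict_congr_set (hitting_ae_eq L)]
  exact ae_restrict_mem (measurableSet_hitSet L)

end HypStick
end

theorem lemma3p3 (L : ℝ) (hL : 0 < L) :
    (∀ᵐ q ∂HypStick.stickMeasure.restrict (HypStick.hitting L),
      ∃! t : ℝ × ℝ × ℝ, HypStick.IsAltCoord L q.1 q.2 t.1 t.2.1 t.2.2) ∧
    AEMeasurable (HypStick.altCoord L)
      (HypStick.stickMeasure.restrict (HypStick.hitting L)) ∧
    MeasureTheory.Measure.map (HypStick.altCoord L)
      (HypStick.stickMeasure.restrict (HypStick.hitting L)) = HypStick.altMeasure L := by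
  have hae := HypStick.ae_restrict_hitting_mem_hitSet L
  have hcongr : HypStick.altCoord L
      =ᵐ[HypStick.stickMeasure.restrict (HypStick.hitting L)]
      fun q => HypStick.coordAt (HypStick.hitPoint q.1 q.2) q.1 := by
    filter_upwards [hae] with q hq using HypStick.altCoord_of_mem_hitSet hq
  have hmeas := HypStick.measurable_coordAt_hitPoint
  refine ⟨?_, hmeas.aemeasurable.congr hcongr.symm, ?_⟩
  · filter_upwards [hae] with q hq
    exact ⟨_, (HypStick.isAltCoord_iff_of_mem_hitSet hq _).2 rfl,
      fun t ht => (HypStick.isAltCoord_iff_of_mem_hitSet hq t).1 ht⟩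
  · rw [MeasureTheory.Measure.map_congr hcongr,
      MeasureTheory.Measure.restrict_congr_set (HypStick.hitting_ae_eq L)]
    refine MeasureTheory.Measure.ext_of_lintegral _ fun f hf => ?_
    rw [MeasureTheory.lintegral_map hf hmeas, HypStick.lintegral_coordAt_hitSet L hf]
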